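/- Consider $k$ slots with click-through rates $\theta_1>\theta_2>\dots>\theta_k>0$ and $n\ge k$ players, where player $i$ has a valuation per click $v_i\ge 0$ and a budget $B_i\ge 0$, and the budgets $B_1,\dots,B_n$ are pairwise distinct. An assignment consists of an allocation that gives each player at most one slot and each slot to at most one player, together with prices per click $p(i)\ge 0$, one for each player $i$, where $p(i)=0$ if $i$ gets no slot. Write $s(i)$ for the slot of a player $i$ who gets one. The utility $u_i$ of player $i$ is $0$ if $i$ gets no slot; otherwise it is $\theta_{s(i)}(v_i-p(i))$ if $\theta_{s(i)}p(i)\le B_i$, and $-\infty$ if $\theta_{s(i)}p(i)>B_i$. An assignment is called envy-free if every slot is assigned to some player and, for every player $i$ and every player $i'$ who gets a slot, $$u_i\ \ge\ \begin{cases}\max\{\theta_{s(i')}(v_i-p(i')),\,0\} & \text{if } \theta_{s(i')}\,p(i')\le B_i,\\ 0 & \text{otherwise.}\end{cases}$$ Then an envy-free assignment always exists. In particular it respects all budgets: $\theta_{s(i)}p(i)\le B_i$ for every player $i$ who gets a slot. -/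

import Mathlib

namespace SlotAuction

/-- A sponsored search instance with `k` slots and `n` players. Slots are indexed in order of
decreasing click-through rate. -/
structure Instance (k n : ℕ) where
  /-- click-through rate of each slot (clicks per period) -/
  ctr : Fin k → ℝ
  /-- valuation per click of each player -/
  value : Fin n → ℝ
  /-- budget of each player for the whole period -/
  budget : Fin n → ℝ
  ctr_pos : ∀ t, 0 < ctr t
  ctr_strictAnti : StrictAnti ctr
  value_nonneg : ∀ i, 0 ≤ value i
  budget_nonneg : ∀ i, 0 ≤ budget i
  budget_injective : Function.Injective budget

/-- A slot allocation together with nonnegative prices per click: `slot i` is the slot of player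
`i`, or `none` if `i` gets no slot; no slot is given to two players; players without a slot
are not charged. -/
structure Assignment (k n : ℕ) where
  slot : Fin n → Option (Fin k)
  price : Fin n → ℝ
  slot_unique : ∀ i j t, slot i = some t → slot j = some t → i = j
  price_nonneg : ∀ i, 0 ≤ price i
  price_unassigned : ∀ i, slot i = none → price i = 0

variable {k n : ℕ}

/-- Player `i` can afford slot `t` at price `p` per click. -/
def Instance.CanAfford (I : Instance k n) (i : Fin n) (t : Fin k) (p : ℝ) : Prop :=
  I.ctr t * p ≤ I.budget i

open Classical in
/-- The utility of player `i`: zero without a slot, `-∞` if the budget is violated. -/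
noncomputable def Instance.utility (I : Instance k n) (A : Assignment k n) (i : Fin n) : EReal :=
  match A.slot i with
  | none => 0
  | some t =>
    if I.CanAfford i t (A.price i) then ((I.ctr t * (I.value i - A.price i) : ℝ) : EReal) else ⊥

open Classical in
/-- An envy-free assignment: every slot is assigned, and the utility of each player `i` is at
least what `i` would obtain (or zero, if that is larger) from the slot of any player `j` at the
price paid by `j`, if `i` can afford it, and at least zero otherwise. -/
def Instance.IsEnvyFree (I : Instance k n) (A : Assignment k n) : Prop :=
  (∀ t, ∃ i, A.slot i = some t) ∧
  ∀ i j t, A.slot j = some t →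
    (if I.CanAfford i t (A.price j)
      then ((max (I.ctr t * (I.value i - A.price j)) 0 : ℝ) : EReal) else 0) ≤ I.utility A i

end SlotAuction

/-! Prices are kept per period, not per click, and slots are added by decreasing click-through rate.
The inductive statement `Instance.exists_stable` allows a reserve price, outside options, and unsold
slots at the reserve price.

To add a slot `a` of lowest rate, offer it at price `y` to everybody: it turns into an outside
option, and `y` into the reserve price of the other slots. The induction hypothesis gives a stable
matching for each `y`. It extends to `a` once at most one player without a slot strictly gains from
`a` at an affordable price `y` and, unless `y` is the old reserve price, some such player at least
weakly wants `a`. A suitable `y` lies at or just above the supremum of the prices at which two or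
more players wait (`Instance.exists_price`).

This works because demand cannot collapse: by `Instance.Stable.card_waiting_le`, apart from players
whose gain is passed by the price, waiting players are lost only as budgets are passed, and distinct
budgets are passed one at a time. That comparison first makes the prices comparable by a pointwise
minimum (`Instance.Stable.exists_meet`), then counts players against slots.

With reserve price zero, the slots left unsold are finally given away for free. -/

namespace SlotAuction

variable {k n : ℕ}

/-! ### Stable matchings with a reserve price and outside options -/

/-- The utility of player `i` under the matching `μ` at total slot prices `P`, where `g` lists the
outside options. -/
def Instance.payoff (I : Instance k n) (g : Fin n → ℝ) (P : Fin k → ℝ)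
    (μ : Fin n → Option (Fin k)) (i : Fin n) : ℝ :=
  (μ i).elim (g i) fun t => I.ctr t * I.value i - P t

/-- A partial matching `μ` of players to the slots in `T` that is envy-free at total slot prices
`P ≥ x`, where player `i` has an outside option of worth `g i`. -/
structure Instance.Stable (I : Instance k n) (T : Finset (Fin k)) (x : ℝ) (g : Fin n → ℝ)
    (P : Fin k → ℝ) (μ : Fin n → Option (Fin k)) : Prop where
  mem : ∀ i t, μ i = some t → t ∈ T
  inj : ∀ i j t, μ i = some t → μ j = some t → i = j
  floor : ∀ t ∈ T, x ≤ P t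
  afford : ∀ i t, μ i = some t → P t ≤ I.budget i
  outside_le : ∀ i, g i ≤ I.payoff g P μ i
  envy_free : ∀ i, ∀ t ∈ T, P t ≤ I.budget i →
    I.ctr t * I.value i - P t ≤ I.payoff g P μ i

/-- Every slot in `T` is taken. -/
def Full (T : Finset (Fin k)) (μ : Fin n → Option (Fin k)) : Prop :=
  ∀ t ∈ T, ∃ i, μ i = some t

variable {I : Instance k n} {T : Finset (Fin k)} {x x' : ℝ} {g g' : Fin n → ℝ}
  {P P' : Fin k → ℝ} {μ μ' : Fin n → Option (Fin k)}

theorem Instance.payoff_some {i : Fin n} {t : Fin k} (h : μ i = some t) :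
    I.payoff g P μ i = I.ctr t * I.value i - P t := by
  simp [Instance.payoff, h]

theorem Instance.payoff_none {i : Fin n} (h : μ i = none) : I.payoff g P μ i = g i := by
  simp [Instance.payoff, h]

/-- If the better slot were cheaper, the holder of the worse one could afford it and would envy its
holder. -/
theorem Instance.Stable.price_mono (h : I.Stable T x g P μ) (hf : Full T μ) {s t : Fin k}
    (hs : s ∈ T) (ht : t ∈ T) (hst : I.ctr s ≤ I.ctr t) : P s ≤ P t := by
  obtain ⟨i, hi⟩ := hf s hs
  by_contra! hlt
  have h1 := h.envy_free i t ht (hlt.le.trans (h.afford i s hi))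
  rw [Instance.payoff_some hi] at h1
  have h2 := mul_le_mul_of_nonneg_right hst (I.value_nonneg i)
  linarith

/-- A player whose slot is cheaper in a second stable matching, with worse outside options, holds
a cheaper slot there too. -/
theorem Instance.Stable.cheaper_of_cheaper (h : I.Stable T x g P μ) (h' : I.Stable T x' g' P' μ')
    (hg : ∀ i, g' i ≤ g i) {i : Fin n} {t : Fin k} (hi : μ i = some t) (hlt : P' t < P t) :
    ∃ s, μ' i = some s ∧ P' s < P s := by
  have ht := h.mem i t hi
  have h1 := h'.envy_free i t ht (hlt.le.trans (h.afford i t hi))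
  have h2 := h.outside_le i
  have h3 := Instance.payoff_some (I := I) (g := g) (P := P) hi
  rcases hs : μ' i with _ | s
  · rw [Instance.payoff_none hs] at h1
    linarith [hg i]
  · refine ⟨s, rfl, ?_⟩
    by_contra! hle
    have h4 := h.envy_free i s (h'.mem i s hs) (hle.trans (h'.afford i s hs))
    rw [Instance.payoff_some hs] at h1
    linarith

/-- The players who do not hold a cheaper slot in the second matching do not gain in it. -/
theorem Instance.Stable.payoff_le_of_not_cheaper (h : I.Stable T x g P μ)
    (h' : I.Stable T x' g' P' μ') (hg : ∀ i, g' i ≤ g i) {i : Fin n}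
    (hi : ∀ s, μ' i = some s → P s ≤ P' s) : I.payoff g' P' μ' i ≤ I.payoff g P μ i := by
  rcases hs : μ' i with _ | s
  · rw [Instance.payoff_none hs]
    exact (hg i).trans (h.outside_le i)
  · have hle := hi s hs
    have h4 := h.envy_free i s (h'.mem i s hs) (hle.trans (h'.afford i s hs))
    rw [Instance.payoff_some hs]
    linarith

/-! ### Counting, and the minimum of two stable price vectors -/

theorem card_filter_assigned_le (hinj : ∀ i j t, μ i = some t → μ j = some t → i = j)
    (N : Finset (Fin n)) (S : Finset (Fin k)) (hN : ∀ i ∈ N, ∃ t ∈ S, μ i = some t) :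
    N.card ≤ S.card := by
  rw [← Finset.card_image_of_injective S (Option.some_injective _)]
  refine Finset.card_le_card_of_injOn μ (fun i hi => ?_) fun i hi j hj hij => ?_
  · obtain ⟨t, ht, h⟩ := hN i hi
    simpa [h] using ht
  · obtain ⟨t, ht, h⟩ := hN i hi
    exact hinj i j t h (hij ▸ h)

theorem card_le_card_filter_assigned (N : Finset (Fin n)) (S : Finset (Fin k))
    (hS : ∀ t ∈ S, ∃ i ∈ N, μ i = some t) : S.card ≤ N.card := by
  rw [← Finset.card_image_of_injective S (Option.some_injective _)]
  refine Finset.card_le_card_of_surjOn μ fun o ho => ?_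
  obtain ⟨t, ht, rfl⟩ := by simpa using ho
  obtain ⟨i, hi, h⟩ := hS t ht
  exact ⟨i, hi, h⟩

/-- The pointwise minimum of two stable price vectors is stable. -/
theorem Instance.Stable.exists_meet (h : I.Stable T x g P μ) (hf : Full T μ)
    (h' : I.Stable T x' g' P' μ') (hx : x ≤ x') (hg : ∀ i, g' i ≤ g i) :
    ∃ Q ν, I.Stable T x g Q ν ∧ Full T ν ∧ (∀ t, Q t ≤ P' t) ∧
      ∀ i, ν i = none ↔ μ i = none := by
  classical
  let R : Finset (Fin k) := T.filter fun t => P' t < P t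
  let S : Finset (Fin n) := Finset.univ.filter fun i => ∃ t ∈ R, μ i = some t
  let S' : Finset (Fin n) := Finset.univ.filter fun i => ∃ t ∈ R, μ' i = some t
  have hSS' : S ⊆ S' := by
    intro i hi
    obtain ⟨t, ht, hit⟩ := (Finset.mem_filter.1 hi).2
    obtain ⟨s, hs, hlt⟩ := h.cheaper_of_cheaper h' hg hit (Finset.mem_filter.1 ht).2
    exact Finset.mem_filter.2
      ⟨Finset.mem_univ _, s, Finset.mem_filter.2 ⟨h'.mem i s hs, hlt⟩, hs⟩
  have hS'R : S'.card ≤ R.card :=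
    card_filter_assigned_le h'.inj S' R fun i hi => (Finset.mem_filter.1 hi).2
  have hRS : R.card ≤ S.card := by
    refine card_le_card_filter_assigned (μ := μ) S R fun t ht => ?_
    obtain ⟨i, hi⟩ := hf t (Finset.mem_filter.1 ht).1
    exact ⟨i, Finset.mem_filter.2 ⟨Finset.mem_univ _, t, ht, hi⟩, hi⟩
  -- The slots that are cheaper under `P'` are thus held by the same players in both matchings, so
  -- these players can be switched to `μ'` without disturbing the others.
  have hSeq : S = S' := Finset.eq_of_subset_of_card_le hSS' (hS'R.trans hRS)
  have hsold : ∀ t ∈ R, ∃ i ∈ S, μ' i = some t := by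
    intro t ht
    by_contra! hno
    have : S.card ≤ (R.erase t).card := by
      refine card_filter_assigned_le h'.inj S _ fun i hi => ?_
      obtain ⟨s, hs, his⟩ := (Finset.mem_filter.1 (hSS' hi)).2
      refine ⟨s, Finset.mem_erase.2 ⟨?_, hs⟩, his⟩
      rintro rfl
      exact hno i hi his
    have := Finset.card_erase_lt_of_mem ht
    omega
  have hSmem : ∀ i t, μ i = some t → P' t < P t → i ∈ S := fun i t hi hlt =>
    Finset.mem_filter.2
      ⟨Finset.mem_univ _, t, Finset.mem_filter.2 ⟨h.mem i t hi, hlt⟩, hi⟩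
  have hS'mem : ∀ i t, μ' i = some t → P' t < P t → i ∈ S := fun i t hi hlt =>
    hSeq ▸ Finset.mem_filter.2
      ⟨Finset.mem_univ _, t, Finset.mem_filter.2 ⟨h'.mem i t hi, hlt⟩, hi⟩
  have hSlt' : ∀ i t, i ∈ S → μ' i = some t → P' t < P t := by
    intro i t hi hit
    obtain ⟨s, hs, his⟩ := (Finset.mem_filter.1 (hSS' hi)).2
    obtain rfl : s = t := Option.some_injective _ (his.symm.trans hit)
    exact (Finset.mem_filter.1 hs).2
  have hSsome : ∀ i ∈ S, (∃ t, μ i = some t ∧ P' t < P t) ∧ ∃ t, μ' i = some t := by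
    intro i hi
    obtain ⟨t, ht, hit⟩ := (Finset.mem_filter.1 hi).2
    obtain ⟨s, hs, his⟩ := (Finset.mem_filter.1 (hSS' hi)).2
    exact ⟨⟨t, hit, (Finset.mem_filter.1 ht).2⟩, s, his⟩
  let Q : Fin k → ℝ := fun t => min (P t) (P' t)
  let ν : Fin n → Option (Fin k) := fun i => if i ∈ S then μ' i else μ i
  have hνS : ∀ i ∈ S, ν i = μ' i := fun i hi => if_pos hi
  have hνn : ∀ i, i ∉ S → ν i = μ i := fun i hi => if_neg hi
  have hpS : ∀ i ∈ S, I.payoff g Q ν i = I.payoff g' P' μ' i := by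
    intro i hi
    obtain ⟨-, t, ht⟩ := hSsome i hi
    rw [Instance.payoff_some ht, Instance.payoff_some ((hνS i hi).trans ht)]
    simp only [Q, min_eq_right (hSlt' i t hi ht).le]
  have hpn : ∀ i, i ∉ S → I.payoff g Q ν i = I.payoff g P μ i := by
    intro i hi
    rcases ht : μ i with _ | t
    · rw [Instance.payoff_none ht, Instance.payoff_none ((hνn i hi).trans ht)]
    · rw [Instance.payoff_some ht, Instance.payoff_some ((hνn i hi).trans ht)]
      have : P t ≤ P' t := by
        by_contra! hlt
        exact hi (hSmem i t ht hlt)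
      simp only [Q, min_eq_left this]
  have hgain : ∀ i ∈ S, I.payoff g P μ i ≤ I.payoff g' P' μ' i := by
    intro i hi
    obtain ⟨⟨t, hit, hlt⟩, -⟩ := hSsome i hi
    have := h'.envy_free i t (h.mem i t hit) (hlt.le.trans (h.afford i t hit))
    rw [Instance.payoff_some hit]
    linarith
  have hloss : ∀ i, i ∉ S → I.payoff g' P' μ' i ≤ I.payoff g P μ i := by
    intro i hi
    refine h.payoff_le_of_not_cheaper h' hg fun s hs => ?_
    by_contra! hlt
    exact hi (hS'mem i s hs hlt)
  refine ⟨Q, ν, ⟨?_, ?_, ?_, ?_, ?_, ?_⟩, ?_, fun t => min_le_right _ _, ?_⟩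
  · intro i t hit
    by_cases hi : i ∈ S
    · exact h'.mem i t (hνS i hi ▸ hit)
    · exact h.mem i t (hνn i hi ▸ hit)
  · intro i j t hit hjt
    by_cases hi : i ∈ S <;> by_cases hj : j ∈ S
    · exact h'.inj i j t (hνS i hi ▸ hit) (hνS j hj ▸ hjt)
    · rw [hνS i hi] at hit
      rw [hνn j hj] at hjt
      exact absurd (hSmem j t hjt (hSlt' i t hi hit)) hj
    · rw [hνS j hj] at hjt
      rw [hνn i hi] at hit
      exact absurd (hSmem i t hit (hSlt' j t hj hjt)) hi
    · exact h.inj i j t (hνn i hi ▸ hit) (hνn j hj ▸ hjt)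
  · exact fun t ht => le_min (h.floor t ht) (hx.trans (h'.floor t ht))
  · intro i t hit
    by_cases hi : i ∈ S
    · exact (min_le_right _ _).trans (h'.afford i t (hνS i hi ▸ hit))
    · exact (min_le_left _ _).trans (h.afford i t (hνn i hi ▸ hit))
  · intro i
    by_cases hi : i ∈ S
    · rw [hpS i hi]
      exact (h.outside_le i).trans (hgain i hi)
    · rw [hpn i hi]
      exact h.outside_le i
  · intro i t ht hb
    have hcase : I.ctr t * I.value i - Q t ≤
        max (I.payoff g P μ i) (I.payoff g' P' μ' i) := by
      rcases le_total (P t) (P' t) with hle | hle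
      · simp only [Q, min_eq_left hle] at hb ⊢
        exact le_max_of_le_left (h.envy_free i t ht hb)
      · simp only [Q, min_eq_right hle] at hb ⊢
        exact le_max_of_le_right (h'.envy_free i t ht hb)
    by_cases hi : i ∈ S
    · rw [hpS i hi]
      rwa [max_eq_right (hgain i hi)] at hcase
    · rw [hpn i hi]
      rwa [max_eq_left (hloss i hi)] at hcase
  · intro t ht
    by_cases hlt : P' t < P t
    · obtain ⟨i, hi, hit⟩ := hsold t (Finset.mem_filter.2 ⟨ht, hlt⟩)
      exact ⟨i, (hνS i hi).trans hit⟩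
    · obtain ⟨i, hit⟩ := hf t ht
      have hi : i ∉ S := by
        intro hi
        obtain ⟨⟨s, his, hs⟩, -⟩ := hSsome i hi
        obtain rfl : s = t := Option.some_injective _ (his.symm.trans hit)
        exact hlt hs
      exact ⟨i, (hνn i hi).trans hit⟩
  · intro i
    by_cases hi : i ∈ S
    · obtain ⟨⟨t, ht, -⟩, s, hs⟩ := hSsome i hi
      simp [hνS i hi, ht, hs]
    · rw [hνn i hi]

/-! ### Demand for the lowest slot as its price rises -/

/-- The outside options when, in addition to the options `g`, slot `a` is available to everybody
at price `x`. -/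
def Instance.withSlot (I : Instance k n) (g : Fin n → ℝ) (a : Fin k) (x : ℝ) (i : Fin n) : ℝ :=
  max (g i) (I.ctr a * I.value i - x)

/-- The gain of player `i` from slot `a`, at price zero, over the outside option. -/
def Instance.gain (I : Instance k n) (g : Fin n → ℝ) (a : Fin k) (i : Fin n) : ℝ :=
  I.ctr a * I.value i - g i

open Classical in
/-- The players with budget at least `y` who are without a slot, although they gain more than `x`
from slot `a`. -/
noncomputable def Instance.waiting (I : Instance k n) (g : Fin n → ℝ) (a : Fin k)
    (μ : Fin n → Option (Fin k)) (x y : ℝ) : Finset (Fin n) :=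
  Finset.univ.filter fun i => y ≤ I.budget i ∧ x < I.gain g a i ∧ μ i = none

variable {a : Fin k}

-- The slots held by players who gain at most `x` from `a` form a barrier: a player who gains more
-- and can afford one of them holds a better slot. Players priced out of the barrier include all
-- waiting players and all holders of the slots below it. At the higher prices `P'` they can still
-- get only slots below it, so their excess over these slots persists, except for budgets under
-- `x'`.
open Classical in
theorem Instance.Stable.card_waiting_le_of_price_le
    (h : I.Stable T x (I.withSlot g a x) P μ) (hf : Full T μ)
    (h' : I.Stable T x' g' P' μ') (hP : ∀ t, P t ≤ P' t)
    (hT : ∀ t ∈ T, I.ctr a < I.ctr t)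
    (hmono : ∀ i j, I.value i ≤ I.value j → I.gain g a i ≤ I.gain g a j) :
    (I.waiting g a μ x x).card ≤ (I.waiting g a μ' x x').card +
      (Finset.univ.filter fun i => x ≤ I.budget i ∧ I.budget i < x').card := by
  let low : Finset (Fin k) :=
    T.filter fun q => ∃ l, μ l = some q ∧ I.gain g a l ≤ x
  -- Single crossing: `l` weakly prefers `q` to `a` and to any affordable slot of lower rate, so
  -- `i`, whose value is larger, strictly prefers `q`.
  have key : ∀ q ∈ low, ∀ i, x < I.gain g a i → P q ≤ I.budget i →
      ∃ t, μ i = some t ∧ I.ctr q < I.ctr t := by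
    intro q hq i hi hb
    obtain ⟨hqT, l, hl, hlx⟩ := Finset.mem_filter.1 hq
    have hv : I.value l < I.value i := by
      by_contra! hle
      linarith [hmono i l hle]
    have hiq := h.envy_free i q hqT hb
    rcases ht : μ i with _ | t
    · exfalso
      rw [Instance.payoff_none ht, Instance.withSlot,
        max_eq_right (by unfold Instance.gain at hi; linarith)] at hiq
      have hlo := (le_max_right _ _).trans (h.outside_le l)
      rw [Instance.payoff_some hl] at hlo
      nlinarith [hT q hqT]
    · refine ⟨t, rfl, ?_⟩
      by_contra! hle
      have hne : I.ctr t ≠ I.ctr q := by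
        intro he
        obtain rfl := I.ctr_strictAnti.injective he
        obtain rfl := h.inj i l t ht hl
        exact lt_irrefl _ hv
      have hlt := lt_of_le_of_ne hle hne
      have htT := h.mem i t ht
      have hlt' := h.envy_free l t htT
        ((h.price_mono hf htT hqT hle).trans (h.afford l q hl))
      rw [Instance.payoff_some hl] at hlt'
      rw [Instance.payoff_some ht] at hiq
      nlinarith
  let N : Finset (Fin n) := Finset.univ.filter fun i =>
    x ≤ I.budget i ∧ x < I.gain g a i ∧ ∀ q ∈ low, I.budget i < P q
  let below : Finset (Fin k) := T.filter fun t => ∀ q ∈ low, I.ctr t < I.ctr q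
  have hN : (I.waiting g a μ x x).card + below.card ≤ N.card := by
    have h1 : I.waiting g a μ x x ⊆ N.filter fun i => μ i = none := by
      intro i hi
      obtain ⟨hb, hg, hn⟩ := (Finset.mem_filter.1 hi).2
      refine Finset.mem_filter.2 ⟨Finset.mem_filter.2 ⟨Finset.mem_univ _, hb, hg, ?_⟩, hn⟩
      intro q hq
      by_contra! hle
      obtain ⟨t, ht, -⟩ := key q hq i hg hle
      simp [hn] at ht
    have h2 : below.card ≤ (N.filter fun i => ¬ μ i = none).card := by
      refine card_le_card_filter_assigned (μ := μ) _ _ fun t ht => ?_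
      obtain ⟨htT, htl⟩ := Finset.mem_filter.1 ht
      obtain ⟨i, hi⟩ := hf t htT
      have hg : x < I.gain g a i := by
        by_contra! hle
        exact lt_irrefl _ (htl t (Finset.mem_filter.2 ⟨htT, i, hi, hle⟩))
      refine ⟨i, Finset.mem_filter.2 ⟨Finset.mem_filter.2 ⟨Finset.mem_univ _,
        (h.floor t htT).trans (h.afford i t hi), hg, ?_⟩, by simp [hi]⟩, hi⟩
      intro q hq
      by_contra! hle
      obtain ⟨s, hs, hlt⟩ := key q hq i hg hle
      obtain rfl : s = t := Option.some_injective _ (hs.symm.trans hi)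
      exact lt_asymm hlt (htl q hq)
    have h3 := Finset.card_filter_add_card_filter_not (s := N) (fun i => μ i = none)
    have h4 := Finset.card_le_card h1
    omega
  have hN' : (N.filter fun i => ¬ μ' i = none).card ≤ below.card := by
    refine card_filter_assigned_le h'.inj _ _ fun i hi => ?_
    obtain ⟨hiN, hne⟩ := Finset.mem_filter.1 hi
    obtain ⟨t, ht⟩ := Option.ne_none_iff_exists'.1 hne
    have htT := h'.mem i t ht
    refine ⟨t, Finset.mem_filter.2 ⟨htT, fun q hq => ?_⟩, ht⟩
    by_contra! hle
    have h1 := h.price_mono hf (Finset.mem_filter.1 hq).1 htT hle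
    have h2 := (Finset.mem_filter.1 hiN).2.2.2 q hq
    linarith [hP t, h'.afford i t ht]
  have hsub : (N.filter fun i => μ' i = none) ⊆ I.waiting g a μ' x x' ∪
      Finset.univ.filter fun i => x ≤ I.budget i ∧ I.budget i < x' := by
    intro i hi
    obtain ⟨hiN, hn⟩ := Finset.mem_filter.1 hi
    obtain ⟨hb, hg, -⟩ := (Finset.mem_filter.1 hiN).2
    rcases lt_or_ge (I.budget i) x' with hlt | hge
    · exact Finset.mem_union_right _ (Finset.mem_filter.2 ⟨Finset.mem_univ _, hb, hlt⟩)
    · exact Finset.mem_union_left _ (Finset.mem_filter.2 ⟨Finset.mem_univ _, hge, hg, hn⟩)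
  have h3 := Finset.card_filter_add_card_filter_not (s := N) (fun i => μ' i = none)
  have h4 := (Finset.card_le_card hsub).trans (Finset.card_union_le _ _)
  omega

open Classical in
/-- When the price of slot `a` rises from `x` to `x'`, then at most the players whose budget lies
in between stop waiting. -/
theorem Instance.Stable.card_waiting_le
    (h : I.Stable T x (I.withSlot g a x) P μ) (hf : Full T μ)
    (h' : I.Stable T x' (I.withSlot g a x') P' μ') (hx : x ≤ x')
    (hT : ∀ t ∈ T, I.ctr a < I.ctr t)
    (hmono : ∀ i j, I.value i ≤ I.value j → I.gain g a i ≤ I.gain g a j) :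
    (I.waiting g a μ x x).card ≤ (I.waiting g a μ' x x').card +
      (Finset.univ.filter fun i => x ≤ I.budget i ∧ I.budget i < x').card := by
  -- Passing to the minimum keeps the set of players without a slot, hence the set of waiting
  -- players.
  obtain ⟨Q, ν, hs, hfν, hQ, hν⟩ := h.exists_meet hf h' hx fun i =>
    max_le_max le_rfl (by linarith)
  have := hs.card_waiting_le_of_price_le hfν h' hQ hT hmono
  simpa only [Instance.waiting, hν] using this

/-- If a player without a slot values the freely available slot `a` positively, then all slots
are taken. -/
theorem Instance.Stable.full_of_none (h : I.Stable T x (I.withSlot g a x) P μ)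
    (hu : ∀ t ∈ T, (∀ i, μ i ≠ some t) → P t = x)
    (hT : ∀ t ∈ T, I.ctr a < I.ctr t) {i : Fin n} (hi : μ i = none)
    (hb : x ≤ I.budget i) (hg : x ≤ I.gain g a i) (hv : 0 < I.value i) : Full T μ := by
  intro t ht
  by_contra! hno
  have hP := hu t ht hno
  have h1 := h.envy_free i t ht (hP.trans_le hb)
  rw [Instance.payoff_none hi, Instance.withSlot,
    max_eq_right (by unfold Instance.gain at hg; linarith), hP] at h1
  nlinarith [hT t ht]

end SlotAuction
namespace SlotAuction

variable {k n : ℕ} {I : Instance k n} {T : Finset (Fin k)} {x y : ℝ} {g : Fin n → ℝ}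
  {P : Fin k → ℝ} {μ : Fin n → Option (Fin k)} {a : Fin k}

/-! ### Adding the lowest slot -/

/-- A stable matching of `T` with slot `a` freely available at price `y` extends to `insert a T`,
once at most one of the players without a slot is to get `a`. -/
theorem Instance.Stable.insert (h : I.Stable T y (I.withSlot g a y) P μ) (ha : a ∉ T)
    (hxy : x ≤ y) {ν : Fin n → Option (Fin k)} (hsome : ∀ i, μ i ≠ none → ν i = μ i)
    (hnone : ∀ i, μ i = none → ν i = none ∧ (y ≤ I.budget i → I.gain g a i ≤ y) ∨
      ν i = some a ∧ y ≤ I.budget i ∧ y ≤ I.gain g a i)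
    (hinj : ∀ i j, ν i = some a → ν j = some a → i = j) :
    I.Stable (insert a T) x g (Function.update P a y) ν := by
  have hne : ∀ t ∈ T, Function.update P a y t = P t := fun t ht =>
    Function.update_of_ne (ne_of_mem_of_not_mem ht ha) _ _
  have hcases : ∀ i t, ν i = some t →
      (t ∈ T ∧ μ i = some t) ∨ (t = a ∧ μ i = none ∧ y ≤ I.budget i ∧ y ≤ I.gain g a i) := by
    intro i t hit
    rcases hs : μ i with _ | s
    · rcases hnone i hs with ⟨h1, -⟩ | ⟨h1, h2⟩
      · simp [h1] at hit
      · exact Or.inr ⟨Option.some_injective _ (hit.symm.trans h1), rfl, h2⟩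
    · have := hsome i (by simp [hs])
      rw [hit, hs] at this
      obtain rfl := Option.some_injective _ this
      exact Or.inl ⟨h.mem i t hs, rfl⟩
  -- A player without a slot whose budget is below `y` is exempt: `withSlot` offers `a` even to
  -- players who cannot pay for it, but such a player can afford no slot at all.
  have hpay : ∀ i, y ≤ I.budget i ∨ μ i ≠ none →
      I.payoff g (Function.update P a y) ν i = I.payoff (I.withSlot g a y) P μ i := by
    intro i hi
    rcases hs : μ i with _ | s
    · rw [Instance.payoff_none hs, Instance.withSlot]
      rcases hnone i hs with ⟨h1, h2⟩ | ⟨h1, -, h2⟩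
      · rw [Instance.payoff_none h1]
        have := h2 (hi.resolve_right (by simp [hs]))
        unfold Instance.gain at this
        rw [max_eq_left (by linarith)]
      · rw [Instance.payoff_some h1, Function.update_self]
        unfold Instance.gain at h2
        rw [max_eq_right (by linarith)]
    · rw [Instance.payoff_some hs, Instance.payoff_some ((hsome i (by simp [hs])).trans hs),
        hne s (h.mem i s hs)]
  refine ⟨?_, ?_, ?_, ?_, ?_, ?_⟩
  · intro i t hit
    rcases hcases i t hit with ⟨ht, -⟩ | ⟨rfl, -⟩
    · exact Finset.mem_insert_of_mem ht
    · exact Finset.mem_insert_self _ _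
  · intro i j t hit hjt
    rcases hcases i t hit with ⟨ht, hi⟩ | ⟨rfl, -⟩
    · rcases hcases j t hjt with ⟨-, hj⟩ | ⟨rfl, -⟩
      · exact h.inj i j t hi hj
      · exact absurd ht ha
    · exact hinj i j hit hjt
  · intro t ht
    rcases Finset.mem_insert.1 ht with rfl | ht
    · rwa [Function.update_self]
    · rw [hne t ht]
      exact hxy.trans (h.floor t ht)
  · intro i t hit
    rcases hcases i t hit with ⟨ht, hi⟩ | ⟨rfl, -, hb, -⟩
    · rw [hne t ht]
      exact h.afford i t hi
    · rwa [Function.update_self]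
  · intro i
    by_cases hi : y ≤ I.budget i ∨ μ i ≠ none
    · rw [hpay i hi]
      exact (le_max_left _ _).trans (h.outside_le i)
    · push Not at hi
      rcases hnone i hi.2 with ⟨h1, -⟩ | ⟨-, h1, -⟩
      · rw [Instance.payoff_none h1]
      · linarith
  · intro i t ht hb
    have hyb : y ≤ I.budget i := by
      rcases Finset.mem_insert.1 ht with rfl | ht
      · rwa [Function.update_self] at hb
      · rw [hne t ht] at hb
        exact (h.floor t ht).trans hb
    rw [hpay i (Or.inl hyb)]
    rcases Finset.mem_insert.1 ht with rfl | ht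
    · rw [Function.update_self]
      exact (le_max_right _ _).trans (h.outside_le i)
    · rw [hne t ht] at hb ⊢
      exact h.envy_free i t ht hb

/-- A finite family of reals above `x` stays above some `y > x`. -/
theorem exists_gt_forall_le {ι : Type*} [Finite ι] (f : ι → ℝ) (x : ℝ) :
    ∃ y, x < y ∧ ∀ i, x < f i → y ≤ f i := by
  have h : ∀ᶠ y in nhdsWithin x (Set.Ioi x), x < y ∧ ∀ i, x < f i → y ≤ f i := by
    refine Filter.Eventually.and self_mem_nhdsWithin (Filter.eventually_all.2 fun i => ?_)
    by_cases hi : x < f i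
    · filter_upwards [Ioo_mem_nhdsGT hi] with y hy _ using hy.2.le
    · exact Filter.Eventually.of_forall fun y hy => absurd hy hi
  exact h.exists

/-- A finite family of reals below `x` stays below some `y < x`. -/
theorem exists_lt_forall_le {ι : Type*} [Finite ι] (f : ι → ℝ) (x : ℝ) :
    ∃ y, y < x ∧ ∀ i, f i < x → f i ≤ y := by
  obtain ⟨y, hy, h⟩ := exists_gt_forall_le (fun i => -f i) (-x)
  exact ⟨-y, by linarith, fun i hi => by linarith [h i (by linarith)]⟩

/-- The price `y` of the lowest slot `a` can be chosen such that at most one player is waiting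
for it and, unless `y` is the reserve price `x`, some player without a slot takes it. -/
theorem Instance.exists_price (I : Instance k n) (g : Fin n → ℝ)
    (E : ℝ → Fin k → ℝ) (M : ℝ → Fin n → Option (Fin k))
    (h : ∀ y, x ≤ y → I.Stable T y (I.withSlot g a y) (E y) (M y))
    (hf : ∀ y, x ≤ y → (I.waiting g a (M y) y y).Nonempty → Full T (M y))
    (hT : ∀ t ∈ T, I.ctr a < I.ctr t)
    (hmono : ∀ i j, I.value i ≤ I.value j → I.gain g a i ≤ I.gain g a j) :
    ∃ y, x ≤ y ∧ (I.waiting g a (M y) y y).card ≤ 1 ∧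
      (y = x ∨ ∃ i, M y i = none ∧ y ≤ I.budget i ∧ y ≤ I.gain g a i) := by
  classical
  by_cases hx : (I.waiting g a (M x) x x).card ≤ 1
  · exact ⟨x, le_rfl, hx, Or.inl rfl⟩
  let X : Set ℝ := {y | x ≤ y ∧ 1 < (I.waiting g a (M y) y y).card}
  have hxX : x ∈ X := ⟨le_rfl, not_le.1 hx⟩
  have hbdd : BddAbove X := by
    obtain ⟨c, hc⟩ := (Set.finite_range (I.gain g a)).bddAbove
    refine ⟨c, fun y hy => ?_⟩
    obtain ⟨i, hi⟩ := Finset.card_pos.1 (zero_lt_one.trans hy.2)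
    exact (Finset.mem_filter.1 hi).2.2.1.le.trans (hc ⟨i, rfl⟩)
  have hle : x ≤ sSup X := le_csSup hbdd hxX
  have hfull : ∀ y ∈ X, Full T (M y) := fun y hy =>
    hf y hy.1 (Finset.card_pos.1 (zero_lt_one.trans hy.2))
  set s := sSup X with hs
  by_cases hsX : s ∈ X
  -- The supremum is attained: move to a `y` so little above `s` that no budget or gain lies
  -- strictly between. Only a budget equal to `s` is passed, so at least one of the two waiting
  -- players is left.
  · obtain ⟨y, hy, hyf⟩ := exists_gt_forall_le (Sum.elim I.budget (I.gain g a)) s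
    have hyx : x ≤ y := hle.trans hy.le
    have hyX : y ∉ X := fun hmem => (le_csSup hbdd hmem).not_gt hy
    have hcomp := (h s hle).card_waiting_le (hfull s hsX) (h y hyx) hy.le hT hmono
    have hone : (Finset.univ.filter fun i => s ≤ I.budget i ∧ I.budget i < y).card ≤ 1 := by
      refine Finset.card_le_one.2 fun i hi j hj => I.budget_injective ?_
      have heq : ∀ l ∈ Finset.univ.filter (fun l => s ≤ I.budget l ∧ I.budget l < y),
          I.budget l = s := by
        intro l hl
        obtain ⟨h1, h2⟩ := (Finset.mem_filter.1 hl).2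
        by_contra hne
        exact (hyf (Sum.inl l) (lt_of_le_of_ne h1 (Ne.symm hne))).not_gt h2
      rw [heq i hi, heq j hj]
    have hpos : 0 < (I.waiting g a (M y) s y).card := by
      have := hsX.2
      omega
    obtain ⟨i, hi⟩ := Finset.card_pos.1 hpos
    obtain ⟨hb, hg, hn⟩ := (Finset.mem_filter.1 hi).2
    exact ⟨y, hyx, not_lt.1 fun hlt => hyX ⟨hyx, hlt⟩, Or.inr ⟨i, hn, hb, hyf (Sum.inr i) hg⟩⟩
  -- The supremum is not attained: compare `s` with a `y` in `X` so close below that no budget or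
  -- gain lies strictly between. No budget is passed, and a gain above `y` is at least `s`.
  · obtain ⟨z, hz, hzf⟩ := exists_lt_forall_le (Sum.elim I.budget (I.gain g a)) s
    obtain ⟨y, hyX, hzy⟩ := exists_lt_of_lt_csSup ⟨x, hxX⟩ hz
    have hys : y ≤ s := le_csSup hbdd hyX
    have hys' : y < s := lt_of_le_of_ne hys fun he => hsX (he ▸ hyX)
    have hcomp := (h y hyX.1).card_waiting_le (hfull y hyX) (h s hle) hys hT hmono
    have hzero : (Finset.univ.filter fun i => y ≤ I.budget i ∧ I.budget i < s) = ∅ := by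
      refine Finset.filter_eq_empty_iff.2 fun i _ hi => ?_
      linarith [hi.1, hzf (Sum.inl i) hi.2, show Sum.elim I.budget (I.gain g a) (Sum.inl i) =
        I.budget i from rfl]
    rw [hzero, Finset.card_empty, add_zero] at hcomp
    obtain ⟨i, hi⟩ := Finset.card_pos.1 (zero_lt_one.trans (hyX.2.trans_le hcomp))
    obtain ⟨hb, hg, hn⟩ := (Finset.mem_filter.1 hi).2
    refine ⟨s, hle, not_lt.1 fun hlt => hsX ⟨hle, hlt⟩, Or.inr ⟨i, hn, hb, ?_⟩⟩
    by_contra! hlt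
    linarith [hzf (Sum.inr i) hlt, show Sum.elim I.budget (I.gain g a) (Sum.inr i) =
        I.gain g a i from rfl]

/-- For every set of slots there is a stable matching whose unsold slots have the reserve price. -/
theorem Instance.exists_stable (I : Instance k n) (T : Finset (Fin k)) : ∀ (x : ℝ) (g : Fin n → ℝ),
    0 ≤ x → (∀ i, 0 ≤ g i) →
    (∀ t ∈ T, ∀ i j, I.value i ≤ I.value j → I.gain g t i ≤ I.gain g t j) →
    ∃ P μ, I.Stable T x g P μ ∧ ∀ t ∈ T, (∀ i, μ i ≠ some t) → P t = x := by
  classical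
  induction T using Finset.induction_on_min_value I.ctr with
  | empty =>
    intro x g _ _ _
    exact ⟨fun _ => 0, fun _ => none,
      ⟨by simp, by simp, by simp, by simp, fun i => le_rfl, by simp⟩, by simp⟩
  | insert a T ha hmin ih =>
    intro x g hx hg hmono
    have hT : ∀ t ∈ T, I.ctr a < I.ctr t := fun t ht =>
      lt_of_le_of_ne (hmin t ht) fun he => ha (I.ctr_strictAnti.injective he ▸ ht)
    have hmono_a := hmono a (Finset.mem_insert_self _ _)
    have hex : ∀ y, ∃ P μ, x ≤ y → I.Stable T y (I.withSlot g a y) P μ ∧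
        ∀ t ∈ T, (∀ i, μ i ≠ some t) → P t = y := by
      intro y
      by_cases hy : x ≤ y
      · suffices hm : ∀ t ∈ T, ∀ i j, I.value i ≤ I.value j →
            I.gain (I.withSlot g a y) t i ≤ I.gain (I.withSlot g a y) t j by
          obtain ⟨P, μ, h⟩ := ih y (I.withSlot g a y) (hx.trans hy)
            (fun i => (hg i).trans (le_max_left _ _)) hm
          exact ⟨P, μ, fun _ => h⟩
        -- The new gain is the minimum of the old gain and `(ctr t - ctr a) * value + y`, both
        -- monotone in the value.
        · intro t ht i j hij
          have h1 := hmono t (Finset.mem_insert_of_mem ht) i j hij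
          have h2 : (I.ctr t - I.ctr a) * I.value i ≤ (I.ctr t - I.ctr a) * I.value j :=
            mul_le_mul_of_nonneg_left hij (sub_nonneg.2 (hT t ht).le)
          unfold Instance.gain at h1 ⊢
          unfold Instance.withSlot
          rcases max_cases (g j) (I.ctr a * I.value j - y) with ⟨h3, -⟩ | ⟨h3, -⟩ <;>
            rw [h3]
          · linarith [le_max_left (g i) (I.ctr a * I.value i - y)]
          · linarith [le_max_right (g i) (I.ctr a * I.value i - y)]
      · exact ⟨fun _ => 0, fun _ => none, fun h => absurd h hy⟩
    choose E M hEM using hex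
    have hvalue : ∀ y i, x ≤ y → y ≤ I.gain g a i → 0 < y ∨ y < I.gain g a i →
        0 < I.value i := by
      intro y i hy h1 h2
      have h3 : 0 < I.ctr a * I.value i := by
        unfold Instance.gain at h1 h2
        rcases h2 with h2 | h2 <;> linarith [hg i]
      exact pos_of_mul_pos_right h3 (I.ctr_pos a).le
    obtain ⟨y, hy, hcard, hor⟩ := I.exists_price g E M (fun y hy => (hEM y hy).1)
      (fun y hy ⟨i, hi⟩ => by
        obtain ⟨hb, hgt, hn⟩ := (Finset.mem_filter.1 hi).2
        exact (hEM y hy).1.full_of_none (hEM y hy).2 hT hn hb hgt.le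
          (hvalue y i hy hgt.le (Or.inr hgt))) hT hmono_a
    obtain ⟨hst, hun⟩ := hEM y hy
    have hwait : ∀ i, M y i = none → i ∉ I.waiting g a (M y) y y → y ≤ I.budget i →
        I.gain g a i ≤ y := by
      intro i hn hi hb
      by_contra! hlt
      exact hi (Finset.mem_filter.2 ⟨Finset.mem_univ _, hb, hlt, hn⟩)
    have hprice : ∀ t ∈ T, Function.update (E y) a y t = E y t := fun t ht =>
      Function.update_of_ne (ne_of_mem_of_not_mem ht ha) _ _
    -- Slot `a` goes to a player who weakly wants it and leaves nobody else waiting. If there is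
    -- none, nobody waits at all, `y` is the reserve price and `a` stays unsold.
    by_cases htake : ∃ i, M y i = none ∧ y ≤ I.budget i ∧ y ≤ I.gain g a i ∧
        I.waiting g a (M y) y y ⊆ {i}
    · obtain ⟨i, hn, hb, hgi, hsub⟩ := htake
      refine ⟨_, Function.update (M y) i (some a), hst.insert ha hy ?_ ?_ ?_, ?_⟩
      · intro j hj
        exact Function.update_of_ne (fun hji : j = i => hj (hji ▸ hn)) _ _
      · intro j hj
        by_cases hji : j = i
        · subst hji
          exact Or.inr ⟨Function.update_self _ _ _, hb, hgi⟩
        · refine Or.inl ⟨(Function.update_of_ne hji _ _).trans hj, hwait j hj fun hmem => ?_⟩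
          exact hji (Finset.mem_singleton.1 (hsub hmem))
      · have : ∀ j, Function.update (M y) i (some a) j = some a → j = i := by
          intro j hj
          by_contra hji
          rw [Function.update_of_ne hji] at hj
          exact ha (hst.mem j a hj)
        exact fun j l hj hl => (this j hj).trans (this l hl).symm
      · intro t ht hno
        rcases Finset.mem_insert.1 ht with rfl | htT
        · exact absurd (Function.update_self _ _ _) (hno i)
        · have hno' : ∀ j, M y j ≠ some t := by
            intro j hj
            refine hno j ?_
            rwa [Function.update_of_ne]
            rintro rfl
            simp [hn] at hj
          rw [hprice t htT, hun t htT hno']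
          -- An unsold slot at a price above the reserve price is impossible: then `y > 0`, so the
          -- taker of `a` has positive value and would have preferred that better slot at the same
          -- price.
          by_contra hne
          have hpos : 0 < y := hx.trans_lt (lt_of_le_of_ne hy (Ne.symm hne))
          obtain ⟨j, hj⟩ := hst.full_of_none hun hT hn hb hgi
            (hvalue y i hy hgi (Or.inl hpos)) t htT
          exact hno' j hj
    · have hempty : I.waiting g a (M y) y y = ∅ := by
        by_contra hne
        obtain ⟨i, hi⟩ := Finset.nonempty_iff_ne_empty.2 hne
        obtain ⟨hb, hgt, hn⟩ := (Finset.mem_filter.1 hi).2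
        exact htake ⟨i, hn, hb, hgt.le, fun j hj =>
          Finset.mem_singleton.2 (Finset.card_le_one.1 hcard j hj i hi)⟩
      have hyx : y = x := by
        rcases hor with h | ⟨i, hn, hb, hgi⟩
        · exact h
        · exact absurd ⟨i, hn, hb, hgi, by simp [hempty]⟩ htake
      refine ⟨_, M y, hst.insert ha hy (fun _ _ => rfl)
        (fun i hi => Or.inl ⟨hi, hwait i hi (by simp [hempty])⟩)
        (fun i j hi => absurd (hst.mem i a hi) ha), ?_⟩
      intro t ht hno
      rcases Finset.mem_insert.1 ht with rfl | htT
      · rw [Function.update_self, hyx]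
      · rw [hprice t htT, hun t htT hno, hyx]

/-! ### Giving away the unsold slots, and the theorem -/

/-- An injective partial matching extends to one in which all `k ≤ n` slots are taken. -/
theorem exists_full_extension (hkn : k ≤ n) (μ : Fin n → Option (Fin k))
    (hinj : ∀ i j t, μ i = some t → μ j = some t → i = j) :
    ∃ ν : Fin n → Option (Fin k), (∀ i j t, ν i = some t → ν j = some t → i = j) ∧
      (∀ t, ∃ i, ν i = some t) ∧ (∀ i, μ i ≠ none → ν i = μ i) := by
  classical
  let S : Finset (Fin k) := Finset.univ.filter fun t => ∃ i, μ i = some t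
  let U : Finset (Fin k) := Finset.univ.filter fun t => ¬ ∃ i, μ i = some t
  let V : Finset (Fin n) := Finset.univ.filter fun i => μ i = none
  let W : Finset (Fin n) := Finset.univ.filter fun i => ¬ μ i = none
  have hW : W.card ≤ S.card := by
    refine card_filter_assigned_le hinj W S fun i hi => ?_
    obtain ⟨t, ht⟩ := Option.ne_none_iff_exists'.1 (Finset.mem_filter.1 hi).2
    exact ⟨t, Finset.mem_filter.2 ⟨Finset.mem_univ _, i, ht⟩, ht⟩
  have hUV : Fintype.card U ≤ Fintype.card V := by
    have h1 : S.card + U.card = k := by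
      rw [Finset.card_filter_add_card_filter_not, Finset.card_univ, Fintype.card_fin]
    have h2 : V.card + W.card = n := by
      rw [Finset.card_filter_add_card_filter_not, Finset.card_univ, Fintype.card_fin]
    simp only [Fintype.card_coe]
    omega
  obtain ⟨e⟩ := Function.Embedding.nonempty_of_card_le hUV
  let f : U → Fin n := fun u => (e u).1
  have hf : Function.Injective f := Subtype.val_injective.comp e.injective
  have hfnone : ∀ u, μ (f u) = none := fun u => (Finset.mem_filter.1 (e u).2).2
  have hpart := hf.isPartialInv
  let ν : Fin n → Option (Fin k) := fun i =>
    if μ i = none then (Function.partialInv f i).map Subtype.val else μ i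
  have hν : ∀ i, μ i ≠ none → ν i = μ i := fun i hi => if_neg hi
  have hcases : ∀ i t, ν i = some t → μ i = some t ∨ ∃ u : U, f u = i ∧ u.1 = t := by
    intro i t hit
    by_cases hi : μ i = none
    · have : (Function.partialInv f i).map Subtype.val = some t := by
        simpa only [ν, if_pos hi] using hit
      obtain ⟨u, hu, hut⟩ := Option.map_eq_some_iff.1 this
      exact Or.inr ⟨u, (hpart u i).1 hu, hut⟩
    · exact Or.inl ((hν i hi).symm.trans hit)
  refine ⟨ν, ?_, ?_, hν⟩
  · intro i j t hit hjt
    rcases hcases i t hit with hi | ⟨u, rfl, hut⟩ <;>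
      rcases hcases j t hjt with hj | ⟨w, rfl, hwt⟩
    · exact hinj i j t hi hj
    · exact absurd ⟨i, hwt ▸ hi⟩ (Finset.mem_filter.1 w.2).2
    · exact absurd ⟨j, hut ▸ hj⟩ (Finset.mem_filter.1 u.2).2
    · rw [Subtype.ext (hut.trans hwt.symm)]
  · intro t
    by_cases ht : ∃ i, μ i = some t
    · obtain ⟨i, hi⟩ := ht
      exact ⟨i, (hν i (by simp [hi])).trans hi⟩
    · let u : U := ⟨t, Finset.mem_filter.2 ⟨Finset.mem_univ _, ht⟩⟩
      refine ⟨f u, ?_⟩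
      simp only [ν, if_pos (hfnone u), (hpart u (f u)).2 rfl, Option.map_some, u]

end SlotAuction

open SlotAuction in
theorem mainTheorem1 (k n : ℕ) (hkn : k ≤ n) (I : SlotAuction.Instance k n) :
    ∃ A : SlotAuction.Assignment k n,
      I.IsEnvyFree A ∧
      ∀ i t, A.slot i = some t → I.CanAfford i t (A.price i) := by
  obtain ⟨P, μ, hst, hun⟩ := I.exists_stable Finset.univ 0 (fun _ => 0) le_rfl (fun _ => le_rfl)
    fun t _ i j hij => by
      simpa [Instance.gain] using mul_le_mul_of_nonneg_left hij (I.ctr_pos t).le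
  obtain ⟨ν, hinj, hfull, hext⟩ := exists_full_extension hkn μ hst.inj
  -- A newly assigned slot was unsold, so it has the reserve price zero: its recipient can afford it
  -- and does not lose by it.
  have hnew : ∀ i t, ν i = some t → μ i = none → P t = 0 := by
    intro i t hit hi
    refine hun t (Finset.mem_univ _) fun j hj => ?_
    obtain rfl := hinj i j t hit ((hext j (by simp [hj])).trans hj)
    simp [hi] at hj
  have hold : ∀ i t, ν i = some t → μ i ≠ none → μ i = some t := fun i t hit hi =>
    (hext i hi).symm.trans hit
  have hafford : ∀ i t, ν i = some t → P t ≤ I.budget i := by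
    intro i t hit
    by_cases hi : μ i = none
    · exact (hnew i t hit hi).trans_le (I.budget_nonneg i)
    · exact hst.afford i t (hold i t hit hi)
  have hpay : ∀ i, I.payoff (fun _ => 0) P μ i ≤ I.payoff (fun _ => 0) P ν i := by
    intro i
    by_cases hi : μ i = none
    · rw [Instance.payoff_none hi]
      rcases hs : ν i with _ | t
      · rw [Instance.payoff_none hs]
      · rw [Instance.payoff_some hs, hnew i t hs hi, sub_zero]
        exact mul_nonneg (I.ctr_pos t).le (I.value_nonneg i)
    · unfold Instance.payoff
      rw [hext i hi]
  let A : Assignment k n :=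
    { slot := ν
      price := fun i => (ν i).elim 0 fun t => P t / I.ctr t
      slot_unique := hinj
      price_nonneg := fun i => by
        rcases ν i with _ | t
        · exact le_rfl
        · exact div_nonneg (hst.floor t (Finset.mem_univ _)) (I.ctr_pos t).le
      price_unassigned := fun i hi => by simp [hi] }
  have hprice : ∀ i t, ν i = some t → I.ctr t * A.price i = P t := by
    intro i t hit
    simp only [A, hit, Option.elim_some]
    exact mul_div_cancel₀ _ (I.ctr_pos t).ne'
  have hcan : ∀ i t, A.slot i = some t → I.CanAfford i t (A.price i) := fun i t hit =>
    (hprice i t hit).trans_le (hafford i t hit)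
  have hutil : ∀ i, I.utility A i = (I.payoff (fun _ => 0) P ν i : ℝ) := by
    intro i
    rcases hs : ν i with _ | t
    · have hs' : A.slot i = none := hs
      simp [Instance.utility, hs', Instance.payoff_none hs]
    · have hs' : A.slot i = some t := hs
      simp only [Instance.utility, hs', if_pos (hcan i t hs), mul_sub, hprice i t hs,
        Instance.payoff_some hs]
  have hnonneg : ∀ i, 0 ≤ I.payoff (fun _ => 0) P ν i := fun i =>
    (hst.outside_le i).trans (hpay i)
  refine ⟨A, ⟨hfull, fun i j t hjt => ?_⟩, hcan⟩
  rw [hutil]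
  split_ifs with hij
  · rw [EReal.coe_le_coe_iff, mul_sub, hprice j t hjt]
    refine max_le ?_ (hnonneg i)
    exact (hst.envy_free i t (Finset.mem_univ _) ((hprice j t hjt).symm.trans_le hij)).trans
      (hpay i)
  · exact_mod_cast hnonneg i
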